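/- Let $d,k\ge 1$ be integers and $\lambda>0$. Let $\mathcal X_\lambda$ be a homogeneous Poisson point process of intensity $\lambda$ in $\mathbb R^d$. For $t\ge 0$ let $F_{k,\lambda}(t)$ be the maximum number of points of $[0,t]^d\cap\mathcal X_\lambda$ that can be colored with $k$ colors in such a way that any two distinct colored points at Euclidean distance at most $1$ receive different colors (that is, the largest number of vertices in a $k$-colorable induced subgraph of the random geometric graph on $[0,t]^d\cap\mathcal X_\lambda$ with connection radius $1$). Then $F_{k,\lambda}(t)$ is a square-integrable random variable for every $t\ge 0$, and $$\operatorname{Var}\bigl(F_{k,\lambda}(t)\bigr)=\Theta(t^d)\qquad\text{as } t\to\infty,$$ i.e. there are constants $0<c\le C<\infty$ and $t_0$, depending only on $d$, $k$ and $\lambda$, such that $c\,t^d\le \operatorname{Var}(F_{k,\lambda}(t))\le C\,t^d$ for all $t\ge t_0$. -/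

import Mathlib

open MeasureTheory ProbabilityTheory Filter Asymptotics
open scoped ENNReal NNReal

/-- The geometric graph on the point set `V`: two distinct points of `V` are adjacent
iff their distance is at most `r`. -/
def geomGraph {E : Type*} [PseudoMetricSpace E] (r : ℝ) (V : Set E) : SimpleGraph V where
  Adj u v := u ≠ v ∧ dist (u : E) (v : E) ≤ r
  symm := ⟨fun _ _ h => ⟨h.1.symm, by rw [dist_comm]; exact h.2⟩⟩
  loopless := ⟨fun _ h => h.1 rfl⟩

/-- The maximum number of vertices of the geometric graph on `V` that can be properly colored
with `k` colors: the largest cardinality of a finite set `S` of vertices whose induced subgraph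
is `k`-colorable. (For finite `V` the set of these cardinalities is non-empty and bounded.) -/
noncomputable def maxColored {E : Type*} [PseudoMetricSpace E] (k : ℕ) (r : ℝ) (V : Set E) : ℕ :=
  sSup {m : ℕ | ∃ S : Finset V,
    ((geomGraph r V).induce (S : Set V)).Colorable k ∧ S.card = m}

/-- The cube `[0, t]^d`. -/
def cube (d : ℕ) (t : ℝ) : Set (EuclideanSpace ℝ (Fin d)) :=
  {x | ∀ i, x i ∈ Set.Icc 0 t}

/-- `X` is a (homogeneous) Poisson point process of intensity `lam` in `ℝ^d`, defined on the
probability space `(Ω, P)`: a random locally finite subset of `ℝ^d` such that the number of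
points in a bounded Borel set `B` is a random variable that is Poisson distributed with mean
`lam * volume B`, and the numbers of points in finitely many pairwise disjoint bounded Borel sets
are independent. -/
structure IsPoissonProcess {d : ℕ} {Ω : Type*} [MeasurableSpace Ω] (lam : ℝ)
    (X : Ω → Set (EuclideanSpace ℝ (Fin d))) (P : Measure Ω) : Prop where
  locallyFinite : ∀ ω, ∀ B : Set (EuclideanSpace ℝ (Fin d)),
    Bornology.IsBounded B → (X ω ∩ B).Finite
  measurable_count : ∀ B : Set (EuclideanSpace ℝ (Fin d)),
    MeasurableSet B → Bornology.IsBounded B → Measurable fun ω => (X ω ∩ B).ncard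
  map_count : ∀ B : Set (EuclideanSpace ℝ (Fin d)),
    MeasurableSet B → Bornology.IsBounded B →
      P.map (fun ω => (X ω ∩ B).ncard) = poissonMeasure (lam * (volume B).toReal).toNNReal
  indep_count : ∀ (n : ℕ) (B : Fin n → Set (EuclideanSpace ℝ (Fin d))),
    (∀ i, MeasurableSet (B i)) → (∀ i, Bornology.IsBounded (B i)) →
    (∀ i j, i ≠ j → Disjoint (B i) (B j)) →
      iIndepFun (fun i ω => (X ω ∩ B i).ncard) P

/-- The random variable `F_k(t)`: the maximum number of points of the process `X` in the cube
`[0, t]^d` that can be properly colored with `k` colors, when points within distance `1` of each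
other must receive different colors. -/
noncomputable def coloredCount {d : ℕ} {Ω : Type*} (X : Ω → Set (EuclideanSpace ℝ (Fin d)))
    (k : ℕ) (t : ℝ) (ω : Ω) : ℝ :=
  (maxColored k 1 (cube d t ∩ X ω) : ℝ)

/-! Write `F` for the number of colorable points in the cube. Adding or deleting points changes `F`
by at most their number, and counts of the process over disjoint regions are independent. Both
bounds rest on these two facts.

Upper bound (Efron–Stein): reveal the process one unit cell at a time. If `G` is computed with the
new cell emptied, then `G` is independent of that cell, so revealing it raises the variance of the
conditional expectation of `F` by at most the mean of `(F - G) ^ 2`. This is at most the second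
moment of one Poisson count, and there are `O(t ^ d)` cells (`variance_condExp_sup_le`,
`variance_condExp_biUnion_le`).

Lower bound: place order `t ^ d` disjoint balls `D` in the cube, each made of a core `q` of diameter
at most `1` and a shell `A` wide enough to isolate the core. When `A` is vacant, the core is a
clique that interacts with nothing else and contributes exactly `min N k`, where `N` is its number
of points. Let `T` be the vacancy indicator of `A` times the centered `min N k`. The `T` of
different balls are independent, and `cov(F, T) = Var T = σ > 0`. Since `Var(F - ∑ T) ≥ 0`, the
variance of `F` is at least `σ` times the number of balls
(`covariance_maxColored_vacant_mul_truncDev`, `card_mul_le_variance_of_indep`). -/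

/-! ### Deterministic properties of the maximal colorable subset -/

section ColoredSubsets

variable {E : Type*} [PseudoMetricSpace E] {k : ℕ} {r : ℝ}

/-- The points of `S` can be colored with `k` colors so that distinct points of the same color
are at distance greater than `r`. -/
def ColorableOn (k : ℕ) (r : ℝ) (S : Set E) : Prop :=
  ∃ c : E → Fin k, ∀ x ∈ S, ∀ y ∈ S, x ≠ y → c x = c y → r < dist x y

theorem ColorableOn.mono {S T : Set E} (h : ColorableOn k r T) (hST : S ⊆ T) :
    ColorableOn k r S := by
  obtain ⟨c, hc⟩ := h
  exact ⟨c, fun x hx y hy => hc x (hST hx) y (hST hy)⟩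

/-- Replaces the nested subtypes by a coloring of all of `E`; `hk` supplies a dummy color off the
image of `S`. -/
theorem colorable_induce_geomGraph_iff (hk : 0 < k) {V : Set E} (S : Set V) :
    ((geomGraph r V).induce S).Colorable k ↔ ColorableOn k r (Subtype.val '' S) := by
  classical
  constructor
  · rintro ⟨C⟩
    refine ⟨fun x => if h : ∃ hx : x ∈ V, (⟨x, hx⟩ : V) ∈ S then C ⟨⟨x, h.1⟩, h.2⟩ else ⟨0, hk⟩, ?_⟩
    rintro _ ⟨⟨x, hx⟩, hxS, rfl⟩ _ ⟨⟨y, hy⟩, hyS, rfl⟩ hne hc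
    by_contra! hle
    have h1 : ∃ hx : x ∈ V, (⟨x, hx⟩ : V) ∈ S := ⟨hx, hxS⟩
    have h2 : ∃ hx : y ∈ V, (⟨y, hx⟩ : V) ∈ S := ⟨hy, hyS⟩
    simp only [dif_pos h1, dif_pos h2] at hc
    refine C.valid (v := ⟨⟨x, hx⟩, hxS⟩) (w := ⟨⟨y, hy⟩, hyS⟩) ?_ hc
    exact ⟨fun h => hne (congrArg Subtype.val h), hle⟩
  · rintro ⟨c, hc⟩
    refine ⟨SimpleGraph.Coloring.mk (fun v => c v.1.1) ?_⟩
    intro v w hvw heq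
    have hvw' : (v.1 : V) ≠ w.1 ∧ dist (v.1 : E) (w.1 : E) ≤ r := hvw
    exact (hc _ ⟨v.1, v.2, rfl⟩ _ ⟨w.1, w.2, rfl⟩ (fun h => hvw'.1 (Subtype.ext h)) heq).not_ge
      hvw'.2

/-- Colorability passes to subsets, so the attainable cardinalities form an initial segment;
finiteness of `V` bounds them, so the supremum is attained. -/
theorem le_maxColored_iff (hk : 0 < k) {V : Set E} (hV : V.Finite) {m : ℕ} :
    m ≤ maxColored k r V ↔ ∃ S : Finset E, (S : Set E) ⊆ V ∧ ColorableOn k r (S : Set E) ∧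
      S.card = m := by
  classical
  have hset : {m : ℕ | ∃ S : Finset V, ((geomGraph r V).induce (S : Set V)).Colorable k ∧
      S.card = m} = {m : ℕ | ∃ S : Finset E, (S : Set E) ⊆ V ∧ ColorableOn k r (S : Set E) ∧
      S.card = m} := by
    ext m
    constructor
    · rintro ⟨S, hS, rfl⟩
      refine ⟨S.map (Function.Embedding.subtype _), ?_, ?_, by simp⟩
      · intro x hx
        simp only [Finset.coe_map, Function.Embedding.subtype_apply, Set.mem_image] at hx
        obtain ⟨y, -, rfl⟩ := hx
        exact y.2
      · rw [colorable_induce_geomGraph_iff hk] at hS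
        simpa using hS
    · rintro ⟨S, hSV, hS, rfl⟩
      refine ⟨S.subtype (· ∈ V), ?_, ?_⟩
      · rw [colorable_induce_geomGraph_iff hk]
        refine hS.mono ?_
        rintro _ ⟨x, hx, rfl⟩
        simpa using hx
      · rw [Finset.card_subtype, Finset.filter_true_of_mem fun x hx => hSV hx]
  have hbdd : BddAbove {m : ℕ | ∃ S : Finset E, (S : Set E) ⊆ V ∧ ColorableOn k r (S : Set E) ∧
      S.card = m} := by
    refine ⟨V.ncard, ?_⟩
    rintro _ ⟨S, hS, -, rfl⟩
    rw [← Set.ncard_coe_finset]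
    exact Set.ncard_le_ncard hS hV
  unfold maxColored
  rw [hset]
  constructor
  · intro hm
    have hne : {m : ℕ | ∃ S : Finset E, (S : Set E) ⊆ V ∧ ColorableOn k r (S : Set E) ∧
        S.card = m}.Nonempty := ⟨0, ∅, by simp, ⟨fun _ => ⟨0, hk⟩, by simp⟩, by simp⟩
    obtain ⟨S, hSV, hS, hcard⟩ := Nat.sSup_mem hne hbdd
    obtain ⟨T, hTS, hT⟩ := Finset.exists_subset_card_eq (hm.trans hcard.ge)
    exact ⟨T, (Finset.coe_subset.2 hTS).trans hSV, hS.mono (Finset.coe_subset.2 hTS), hT⟩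
  · exact fun h => le_csSup hbdd h

theorem maxColored_mono (hk : 0 < k) {V W : Set E} (hV : V.Finite) (hWV : W ⊆ V) :
    maxColored k r W ≤ maxColored k r V := by
  obtain ⟨S, hS, hc, hcard⟩ := (le_maxColored_iff hk (hV.subset hWV)).1 (le_refl (maxColored k r W))
  exact (le_maxColored_iff hk hV).2 ⟨S, hS.trans hWV, hc, hcard⟩

/-- An optimal set for `V`, cut down to `W`, is still colorable. This Lipschitz property drives the
upper bound. -/
theorem maxColored_le_add_ncard_diff (hk : 0 < k) {V W : Set E} (hV : V.Finite) (hWV : W ⊆ V) :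
    maxColored k r V ≤ maxColored k r W + (V \ W).ncard := by
  classical
  obtain ⟨S, hS, hc, hcard⟩ := (le_maxColored_iff hk hV).1 (le_refl (maxColored k r V))
  rw [← hcard, ← Finset.card_filter_add_card_filter_not (s := S) (· ∈ W)]
  refine add_le_add ((le_maxColored_iff hk (hV.subset hWV)).2 ⟨S.filter (· ∈ W), ?_, ?_, rfl⟩) ?_
  · intro x hx
    simp at hx
    exact hx.2
  · exact hc.mono (Finset.coe_subset.2 (Finset.filter_subset _ _))
  · rw [← Set.ncard_coe_finset]
    refine Set.ncard_le_ncard ?_ hV.sdiff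
    intro x hx
    simp at hx
    exact ⟨hS hx.1, hx.2⟩

theorem maxColored_le_ncard (hk : 0 < k) {V : Set E} (hV : V.Finite) :
    maxColored k r V ≤ V.ncard := by
  obtain ⟨S, hS, -, hcard⟩ := (le_maxColored_iff hk hV).1 (le_refl (maxColored k r V))
  rw [← hcard, ← Set.ncard_coe_finset]
  exact Set.ncard_le_ncard hS hV

/-- No constraint links the two parts, so colorings of them can be glued; `hr` makes the parts
disjoint. -/
theorem maxColored_union_of_separated (hk : 0 < k) (hr : 0 ≤ r) {A B : Set E} (hA : A.Finite)
    (hB : B.Finite) (hAB : ∀ a ∈ A, ∀ b ∈ B, r < dist a b) :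
    maxColored k r (A ∪ B) = maxColored k r A + maxColored k r B := by
  classical
  have hdisj : ∀ a ∈ A, a ∉ B := fun a ha hb => by
    have := hAB a ha a hb
    rw [dist_self] at this
    linarith
  apply le_antisymm
  · obtain ⟨S, hS, hc, hcard⟩ := (le_maxColored_iff hk (hA.union hB)).1
      (le_refl (maxColored k r (A ∪ B)))
    rw [← hcard, ← Finset.card_filter_add_card_filter_not (s := S) (· ∈ A)]
    refine add_le_add ((le_maxColored_iff hk hA).2 ⟨S.filter (· ∈ A), ?_, ?_, rfl⟩)
      ((le_maxColored_iff hk hB).2 ⟨S.filter (¬ · ∈ A), ?_, ?_, rfl⟩)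
    · intro x hx
      simp at hx
      exact hx.2
    · exact hc.mono (Finset.coe_subset.2 (Finset.filter_subset _ _))
    · intro x hx
      simp at hx
      exact (hS hx.1).resolve_left hx.2
    · exact hc.mono (Finset.coe_subset.2 (Finset.filter_subset _ _))
  · obtain ⟨S, hS, ⟨c, hc⟩, hcS⟩ := (le_maxColored_iff hk hA).1 (le_refl (maxColored k r A))
    obtain ⟨T, hT, ⟨c', hc'⟩, hcT⟩ := (le_maxColored_iff hk hB).1 (le_refl (maxColored k r B))
    refine (le_maxColored_iff hk (hA.union hB)).2 ⟨S ∪ T, ?_,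
      ⟨fun x => if x ∈ S then c x else c' x, ?_⟩, ?_⟩
    · rw [Finset.coe_union]
      exact Set.union_subset_union hS hT
    · have hST : ∀ x ∈ T, x ∉ S := fun x hx hxS => hdisj x (hS hxS) (hT hx)
      intro x hx y hy hne heq
      rw [Finset.coe_union] at hx hy
      rcases hx with hx | hx <;> rcases hy with hy | hy
      · simp only [if_pos (Finset.mem_coe.1 hx), if_pos (Finset.mem_coe.1 hy)] at heq
        exact hc x hx y hy hne heq
      · exact hAB x (hS hx) y (hT hy)
      · rw [dist_comm]
        exact hAB y (hS hy) x (hT hx)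
      · simp only [if_neg (hST x hx), if_neg (hST y hy)] at heq
        exact hc' x hx y hy hne heq
    · rw [Finset.card_union_of_disjoint, hcS, hcT]
      exact Finset.disjoint_left.2 fun x hx hx' => hdisj x (hS hx) (hT hx')

/-- The graph is a clique, so each color is used at most once. -/
theorem maxColored_of_dist_le (hk : 0 < k) {A : Set E} (hA : A.Finite)
    (h : ∀ x ∈ A, ∀ y ∈ A, dist x y ≤ r) : maxColored k r A = min A.ncard k := by
  classical
  apply le_antisymm
  · refine le_min (maxColored_le_ncard hk hA) ?_
    obtain ⟨S, hS, ⟨c, hc⟩, hcS⟩ := (le_maxColored_iff hk hA).1 (le_refl (maxColored k r A))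
    rw [← hcS]
    have hinj : Set.InjOn c S := by
      intro x hx y hy heq
      by_contra hne
      exact (hc x hx y hy hne heq).not_ge (h x (hS hx) y (hS hy))
    calc S.card = (S.image c).card := (Finset.card_image_of_injOn hinj).symm
      _ ≤ Fintype.card (Fin k) := Finset.card_le_univ _
      _ = k := Fintype.card_fin k
  · have hm : min A.ncard k ≤ hA.toFinset.card := by
      rw [← Set.ncard_eq_toFinset_card A hA]
      exact min_le_left _ _
    obtain ⟨S, hSA, hcard⟩ := Finset.exists_subset_card_eq hm
    refine (le_maxColored_iff hk hA).2 ⟨S, fun x hx => by simpa using hSA hx, ?_, hcard⟩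
    have hSk : Fintype.card S ≤ Fintype.card (Fin k) := by
      rw [Fintype.card_coe, hcard, Fintype.card_fin]
      exact min_le_right _ _
    obtain ⟨e⟩ := Function.Embedding.nonempty_of_card_le hSk
    refine ⟨fun x => if hx : x ∈ S then e ⟨x, hx⟩ else ⟨0, hk⟩, ?_⟩
    intro x hx y hy hne heq
    simp only [dif_pos (Finset.mem_coe.1 hx), dif_pos (Finset.mem_coe.1 hy)] at heq
    exact absurd (congrArg Subtype.val (e.injective heq)) hne

end ColoredSubsets

/-! ### Sigma-algebras of counts and their independence over disjoint regions -/

section CountAlgebra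

variable {d : ℕ} {Ω : Type*}

/-- The `σ`-algebra generated by the numbers of points of `X` in the bounded Borel subsets of
`B`. -/
@[reducible] noncomputable def countAlgebra (X : Ω → Set (EuclideanSpace ℝ (Fin d))) (B : Set (EuclideanSpace ℝ (Fin d))) :
    MeasurableSpace Ω :=
  ⨆ A : {A : Set (EuclideanSpace ℝ (Fin d)) // MeasurableSet A ∧ Bornology.IsBounded A ∧ A ⊆ B},
    MeasurableSpace.comap (fun ω => (X ω ∩ A.1).ncard) inferInstance

variable {X : Ω → Set (EuclideanSpace ℝ (Fin d))}

theorem measurable_ncard_countAlgebra {A B : Set (EuclideanSpace ℝ (Fin d))}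
    (hA : MeasurableSet A) (hb : Bornology.IsBounded A) (hAB : A ⊆ B) :
    Measurable[countAlgebra X B] fun ω => (X ω ∩ A).ncard :=
  measurable_iff_comap_le.2 (le_iSup (fun A : {A : Set (EuclideanSpace ℝ (Fin d)) //
    MeasurableSet A ∧ Bornology.IsBounded A ∧ A ⊆ B} =>
      MeasurableSpace.comap (fun ω => (X ω ∩ A.1).ncard) inferInstance) ⟨A, hA, hb, hAB⟩)

theorem countAlgebra_le_iff {B : Set (EuclideanSpace ℝ (Fin d))} {m : MeasurableSpace Ω} :
    countAlgebra X B ≤ m ↔ ∀ A : Set (EuclideanSpace ℝ (Fin d)), MeasurableSet A →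
      Bornology.IsBounded A → A ⊆ B → Measurable[m] fun ω => (X ω ∩ A).ncard := by
  constructor
  · exact fun h A hA hb hAB => (measurable_ncard_countAlgebra hA hb hAB).mono h le_rfl
  · exact fun h => iSup_le fun A => measurable_iff_comap_le.1 (h A.1 A.2.1 A.2.2.1 A.2.2.2)

theorem countAlgebra_mono {B C : Set (EuclideanSpace ℝ (Fin d))} (h : B ⊆ C) :
    countAlgebra X B ≤ countAlgebra X C :=
  countAlgebra_le_iff.2 fun _ hA hb hAB => measurable_ncard_countAlgebra hA hb (hAB.trans h)

theorem countAlgebra_empty : countAlgebra X ∅ = ⊥ := by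
  refine le_antisymm (countAlgebra_le_iff.2 fun A _ _ hA => ?_) bot_le
  rw [Set.subset_empty_iff.1 hA]
  simp only [Set.inter_empty, Set.ncard_empty]
  exact measurable_const

/-- A count over `A` is the sum of the counts over `A ∩ U` and `A \ U`; local finiteness makes
`ncard` additive. -/
theorem countAlgebra_union_le
    (hfin : ∀ ω, ∀ B : Set (EuclideanSpace ℝ (Fin d)), Bornology.IsBounded B → (X ω ∩ B).Finite)
    {U V : Set (EuclideanSpace ℝ (Fin d))} (hU : MeasurableSet U) :
    countAlgebra X (U ∪ V) ≤ countAlgebra X U ⊔ countAlgebra X V := by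
  refine countAlgebra_le_iff.2 fun A hA hb hAB => ?_
  have h : (fun ω => (X ω ∩ A).ncard) =
      fun ω => (X ω ∩ (A ∩ U)).ncard + (X ω ∩ (A \ U)).ncard := by
    funext ω
    rw [← Set.ncard_union_eq _ (hfin ω _ (hb.subset Set.inter_subset_left))
      (hfin ω _ (hb.subset Set.sdiff_subset)), ← Set.inter_union_distrib_left, Set.inter_union_sdiff]
    exact Set.disjoint_of_subset Set.inter_subset_right Set.inter_subset_right
      Set.disjoint_sdiff_inter.symm
  rw [h]
  refine Measurable.add ?_ ?_
  · exact (measurable_ncard_countAlgebra (hA.inter hU) (hb.subset Set.inter_subset_left)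
      Set.inter_subset_right).mono le_sup_left le_rfl
  · refine (measurable_ncard_countAlgebra (hA.diff hU) (hb.subset Set.sdiff_subset) ?_).mono
      le_sup_right le_rfl
    exact Set.sdiff_subset_iff.2 hAB

/-- The points of `⋃ A ∈ s, A` whose set of members of `s` containing them is `T`. -/
def atomOf {E : Type*} (s T : Finset (Set E)) : Set E :=
  {x | (∃ A ∈ s, x ∈ A) ∧ ∀ A ∈ s, x ∈ A ↔ A ∈ T}

theorem measurableSet_atomOf {E : Type*} [MeasurableSpace E] {s : Finset (Set E)}
    (hs : ∀ A ∈ s, MeasurableSet A) (T : Finset (Set E)) : MeasurableSet (atomOf s T) := by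
  have h : atomOf s T = (⋃ A ∈ s, A) ∩ ⋂ A ∈ s, {x | x ∈ A ↔ A ∈ T} := by
    ext x
    simp [atomOf]
  rw [h]
  refine (Finset.measurableSet_biUnion s hs).inter (Finset.measurableSet_biInter s fun A hA => ?_)
  by_cases hT : A ∈ T
  · simpa [hT] using hs A hA
  · have h' : {x | x ∈ A ↔ A ∈ T} = Aᶜ := by
      ext x
      simp [hT]
    rw [h']
    exact (hs A hA).compl

theorem atomOf_subset {E : Type*} {s : Finset (Set E)} {B : Set E} (hs : ∀ A ∈ s, A ⊆ B)
    (T : Finset (Set E)) : atomOf s T ⊆ B := by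
  rintro x ⟨⟨A, hA, hx⟩, -⟩
  exact hs A hA hx

theorem isBounded_atomOf {E : Type*} [Bornology E] {s : Finset (Set E)}
    (hs : ∀ A ∈ s, Bornology.IsBounded A) (T : Finset (Set E)) :
    Bornology.IsBounded (atomOf s T) :=
  ((Bornology.isBounded_biUnion_finset s).2 hs).subset
    (atomOf_subset (fun _ hA => Set.subset_biUnion_of_mem (u := id) hA) T)

theorem disjoint_atomOf {E : Type*} {s T T' : Finset (Set E)} (hT : T ⊆ s) (hT' : T' ⊆ s)
    (hne : T ≠ T') : Disjoint (atomOf s T) (atomOf s T') := by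
  refine Set.disjoint_left.2 fun x hx hx' => hne ?_
  ext A
  constructor
  · exact fun hA => (hx'.2 A (hT hA)).1 ((hx.2 A (hT hA)).2 hA)
  · exact fun hA => (hx.2 A (hT' hA)).1 ((hx'.2 A (hT' hA)).2 hA)

open Classical in
theorem ncard_inter_eq_sum_atomOf {E : Type*} {V A : Set E} {s : Finset (Set E)} (hA : A ∈ s)
    (hV : (V ∩ A).Finite) :
    (V ∩ A).ncard = ∑ T ∈ s.powerset with A ∈ T, (V ∩ atomOf s T).ncard := by
  rw [Set.ncard_eq_toFinset_card _ hV,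
    Finset.card_eq_sum_card_fiberwise (f := fun x => s.filter (x ∈ ·))
      (t := s.powerset.filter (A ∈ ·))]
  · refine Finset.sum_congr rfl fun T hT => ?_
    simp only [Finset.mem_filter, Finset.mem_powerset] at hT
    rw [← Set.ncard_coe_finset]
    congr 1
    ext x
    simp only [Finset.coe_filter, Set.Finite.mem_toFinset, Set.mem_inter_iff, Set.mem_ofPred_eq,
      atomOf]
    constructor
    · rintro ⟨⟨hxV, hxA⟩, rfl⟩
      exact ⟨hxV, ⟨A, hA, hxA⟩, fun B hB => by simp [hB]⟩
    · rintro ⟨hxV, -, hx⟩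
      refine ⟨⟨hxV, (hx A hA).2 hT.2⟩, ?_⟩
      ext B
      simp only [Finset.mem_filter]
      exact ⟨fun h => (hx B h.1).1 h.2, fun h => ⟨hT.1 h, (hx B (hT.1 h)).2 h⟩⟩
  · intro x hx
    simp only [Set.Finite.coe_toFinset, Set.mem_inter_iff] at hx
    simp [hA, hx.2]

variable [mΩ : MeasurableSpace Ω] {P : Measure Ω} {lam : ℝ}

theorem IsPoissonProcess.countAlgebra_le (hX : IsPoissonProcess lam X P)
    (B : Set (EuclideanSpace ℝ (Fin d))) : countAlgebra X B ≤ mΩ :=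
  countAlgebra_le_iff.2 fun A hA hb _ => hX.measurable_count A hA hb

theorem IsPoissonProcess.iIndepFun_count (hX : IsPoissonProcess lam X P) {ι : Type*} [Fintype ι]
    (B : ι → Set (EuclideanSpace ℝ (Fin d))) (hm : ∀ i, MeasurableSet (B i))
    (hb : ∀ i, Bornology.IsBounded (B i)) (hd : ∀ i j, i ≠ j → Disjoint (B i) (B j)) :
    iIndepFun (fun i ω => (X ω ∩ B i).ncard) P := by
  have h := hX.indep_count (Fintype.card ι) (fun i => B ((Fintype.equivFin ι).symm i))
    (fun i => hm _) (fun i => hb _) (fun i j hij => hd _ _ (by simpa using hij))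
  have h' := h.precomp (Fintype.equivFin ι).injective
  simpa using h'

/-- The members of `s` may overlap, while the process only gives independence for disjoint sets. The
atoms of `s` and of `t` together are pairwise disjoint, and every count is a sum of atom counts. -/
theorem IsPoissonProcess.indep_iSup_comap_count [IsProbabilityMeasure P]
    (hX : IsPoissonProcess lam X P) {B C : Set (EuclideanSpace ℝ (Fin d))} (hBC : Disjoint B C)
    {s t : Finset (Set (EuclideanSpace ℝ (Fin d)))}
    (hs : ∀ A ∈ s, MeasurableSet A ∧ Bornology.IsBounded A ∧ A ⊆ B)
    (ht : ∀ A ∈ t, MeasurableSet A ∧ Bornology.IsBounded A ∧ A ⊆ C) :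
    Indep (⨆ A ∈ s, MeasurableSpace.comap (fun ω => (X ω ∩ A).ncard) inferInstance)
      (⨆ A ∈ t, MeasurableSpace.comap (fun ω => (X ω ∩ A).ncard) inferInstance) P := by
  classical
  let b : s.powerset ⊕ t.powerset → Set (EuclideanSpace ℝ (Fin d)) :=
    Sum.elim (fun T => atomOf s T) (fun T => atomOf t T)
  have hm : ∀ i, MeasurableSet (b i) := by
    rintro (T | T)
    · exact measurableSet_atomOf (fun A hA => (hs A hA).1) _
    · exact measurableSet_atomOf (fun A hA => (ht A hA).1) _
  have hb : ∀ i, Bornology.IsBounded (b i) := by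
    rintro (T | T)
    · exact isBounded_atomOf (fun A hA => (hs A hA).2.1) _
    · exact isBounded_atomOf (fun A hA => (ht A hA).2.1) _
  have hdisj : ∀ i j, i ≠ j → Disjoint (b i) (b j) := by
    have hst : ∀ T T', Disjoint (atomOf s T) (atomOf t T') := fun T T' =>
      Set.disjoint_of_subset (atomOf_subset (fun A hA => (hs A hA).2.2) _)
        (atomOf_subset (fun A hA => (ht A hA).2.2) _) hBC
    rintro (T | T) (T' | T') hne
    · exact disjoint_atomOf (Finset.mem_powerset.1 T.2) (Finset.mem_powerset.1 T'.2)
        fun h => hne (congrArg _ (Subtype.ext h))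
    · exact hst _ _
    · exact (hst _ _).symm
    · exact disjoint_atomOf (Finset.mem_powerset.1 T.2) (Finset.mem_powerset.1 T'.2)
        fun h => hne (congrArg _ (Subtype.ext h))
  have hind := (hX.iIndepFun_count b hm hb hdisj).iIndep
  have key := indep_iSup_of_disjoint
    (fun i => measurable_iff_comap_le.1 (hX.measurable_count _ (hm i) (hb i))) hind
    (S := Set.range Sum.inl) (T := Set.range Sum.inr) Set.isCompl_range_inl_range_inr.disjoint
  have haux : ∀ (u : Finset (Set (EuclideanSpace ℝ (Fin d)))) (f : u.powerset → _)
      (S : Set (s.powerset ⊕ t.powerset)), (∀ T, f T ∈ S ∧ b (f T) = atomOf u T) →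
      (∀ A ∈ u, Bornology.IsBounded A) →
      (⨆ A ∈ u, MeasurableSpace.comap (fun ω => (X ω ∩ A).ncard) inferInstance) ≤
        ⨆ i ∈ S, MeasurableSpace.comap (fun ω => (X ω ∩ b i).ncard) inferInstance := by
    intro u f S hf hu
    refine iSup₂_le fun A hA => measurable_iff_comap_le.1 ?_
    have heq : (fun ω => (X ω ∩ A).ncard) = fun ω => ∑ T ∈ u.powerset with A ∈ T,
        (X ω ∩ atomOf u T).ncard :=
      funext fun ω => ncard_inter_eq_sum_atomOf hA (hX.locallyFinite ω A (hu A hA))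
    rw [heq]
    refine Finset.measurable_fun_sum _ fun T hT => ?_
    have hT' : T ∈ u.powerset := (Finset.mem_filter.1 hT).1
    obtain ⟨h1, h2⟩ := hf ⟨T, hT'⟩
    simp only at h2
    rw [← h2]
    exact measurable_iff_comap_le.2 (le_iSup₂ (f := fun i (_ : i ∈ S) =>
      MeasurableSpace.comap (fun ω => (X ω ∩ b i).ncard) inferInstance) _ h1)
  refine indep_of_indep_of_le_left (indep_of_indep_of_le_right key ?_) ?_
  · exact haux t Sum.inr _ (fun T => ⟨⟨T, rfl⟩, rfl⟩) fun A hA => (ht A hA).2.1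
  · exact haux s Sum.inl _ (fun T => ⟨⟨T, rfl⟩, rfl⟩) fun A hA => (hs A hA).2.1

/-- Each count algebra is the directed supremum of those generated by finitely many sets, and
independence passes to directed suprema, one side at a time. -/
theorem IsPoissonProcess.indep_countAlgebra [IsProbabilityMeasure P]
    (hX : IsPoissonProcess lam X P) {B C : Set (EuclideanSpace ℝ (Fin d))} (hBC : Disjoint B C) :
    Indep (countAlgebra X B) (countAlgebra X C) P := by
  classical
  have hdir : ∀ D : Set (EuclideanSpace ℝ (Fin d)), countAlgebra X D =
      ⨆ s : {s : Finset (Set (EuclideanSpace ℝ (Fin d))) //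
        ∀ A ∈ s, MeasurableSet A ∧ Bornology.IsBounded A ∧ A ⊆ D},
        ⨆ A ∈ s.1, MeasurableSpace.comap (fun ω => (X ω ∩ A).ncard) inferInstance := by
    intro D
    apply le_antisymm
    · refine iSup_le fun A => ?_
      refine le_trans ?_ (le_iSup _ ⟨{A.1}, by simpa using A.2⟩)
      exact le_iSup₂ (f := fun (B : Set (EuclideanSpace ℝ (Fin d)))
        (_ : B ∈ ({A.1} : Finset (Set (EuclideanSpace ℝ (Fin d))))) =>
        MeasurableSpace.comap (fun ω => (X ω ∩ B).ncard) inferInstance) A.1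
        (Finset.mem_singleton_self _)
    · exact iSup_le fun s => iSup₂_le fun A hA => measurable_iff_comap_le.1
        (measurable_ncard_countAlgebra (s.2 A hA).1 (s.2 A hA).2.1 (s.2 A hA).2.2)
  have hle : ∀ (D : Set (EuclideanSpace ℝ (Fin d))) (s : {s : Finset (Set (EuclideanSpace ℝ (Fin d))) //
        ∀ A ∈ s, MeasurableSet A ∧ Bornology.IsBounded A ∧ A ⊆ D}),
        (⨆ A ∈ s.1, MeasurableSpace.comap (fun ω => (X ω ∩ A).ncard) inferInstance) ≤ mΩ :=
    fun D s => iSup₂_le fun A hA => measurable_iff_comap_le.1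
      (hX.measurable_count A (s.2 A hA).1 (s.2 A hA).2.1)
  have hdirected : ∀ D : Set (EuclideanSpace ℝ (Fin d)), Directed (· ≤ ·)
      fun s : {s : Finset (Set (EuclideanSpace ℝ (Fin d))) //
        ∀ A ∈ s, MeasurableSet A ∧ Bornology.IsBounded A ∧ A ⊆ D} =>
        ⨆ A ∈ s.1, MeasurableSpace.comap (fun ω => (X ω ∩ A).ncard)
          (inferInstance : MeasurableSpace ℕ) := by
    intro D s t
    refine ⟨⟨s.1 ∪ t.1, fun A hA => (Finset.mem_union.1 hA).elim (s.2 A) (t.2 A)⟩, ?_, ?_⟩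
    · exact biSup_mono fun A hA => Finset.mem_union_left _ hA
    · exact biSup_mono fun A hA => Finset.mem_union_right _ hA
  rw [hdir B]
  refine indep_iSup_of_directed_le (fun s => ?_) (hle B) (hX.countAlgebra_le C) (hdirected B)
  rw [hdir C]
  refine Indep.symm (indep_iSup_of_directed_le (fun t => ?_) (hle C) (hle B s) (hdirected C))
  exact (hX.indep_iSup_comap_count hBC s.2 t.2).symm

end CountAlgebra

/-! ### Measurability of the colored count -/

section Measurability

variable {d k : ℕ} {Ω : Type*} {X : Ω → Set (EuclideanSpace ℝ (Fin d))}

/-- Finitely many strict inequalities leave a common margin; `2 * ε` allows both endpoints to move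
by `ε`. -/
theorem exists_pos_forall_two_mul_lt_dist {E ι κ : Type*} [MetricSpace E] [Finite ι] {r : ℝ}
    {x : ι → E} (hx : Function.Injective x) {c : ι → κ}
    (hc : ∀ i j, i ≠ j → c i = c j → r < dist (x i) (x j)) :
    ∃ ε : ℝ, 0 < ε ∧ ∀ i j, i ≠ j → 2 * ε < dist (x i) (x j) ∧
      (c i = c j → 2 * ε < dist (x i) (x j) - r) := by
  have ht : Tendsto (fun ε : ℝ => 2 * ε) (nhdsWithin 0 (Set.Ioi 0)) (nhds 0) := by
    have : Tendsto (fun ε : ℝ => 2 * ε) (nhds 0) (nhds (2 * 0)) :=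
      (continuous_const.mul continuous_id).tendsto 0
    rw [mul_zero] at this
    exact this.mono_left nhdsWithin_le_nhds
  have h : ∀ᶠ ε : ℝ in nhdsWithin 0 (Set.Ioi 0), ∀ i j, i ≠ j → 2 * ε < dist (x i) (x j) ∧
      (c i = c j → 2 * ε < dist (x i) (x j) - r) := by
    refine eventually_all.2 fun i => eventually_all.2 fun j => ?_
    by_cases hij : i = j
    · simp [hij]
    · have h1 := ht.eventually_lt_const (dist_pos.2 (hx.ne hij))
      by_cases hcij : c i = c j
      · filter_upwards [h1, ht.eventually_lt_const (sub_pos.2 (hc i j hij hcij))] with ε h1 h2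
        exact fun _ => ⟨h1, fun _ => h2⟩
      · filter_upwards [h1] with ε h1
        exact fun _ => ⟨h1, fun h => absurd h hcij⟩
  obtain ⟨ε, h1, h2⟩ := (h.and self_mem_nhdsWithin).exists
  exact ⟨ε, h2, h1⟩

/-- The largest number of colorable points of a bounded set is at least `m` iff there are `m`
members of a countable basis, each meeting the set, colored such that points in distinct members
are distinct and points in distinct members of the same color are far apart. -/
theorem le_maxColored_iff_exists_basis {E : Type*} [MetricSpace E] [SecondCountableTopology E]
    {r : ℝ} (hk : 0 < k) {V : Set E} (hV : V.Finite) {m : ℕ} :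
    m ≤ maxColored k r V ↔
      ∃ (u : Fin m → TopologicalSpace.countableBasis E) (c : Fin m → Fin k),
        (∀ i j, i ≠ j → ∀ x ∈ (u i : Set E), ∀ y ∈ (u j : Set E),
          x ≠ y ∧ (c i = c j → r < dist x y)) ∧
        ∀ i, (V ∩ u i).Nonempty := by
  classical
  rw [le_maxColored_iff hk hV]
  constructor
  · rintro ⟨S, hSV, ⟨c, hc⟩, hcard⟩
    let e : Fin m ≃ S := (S.equivFinOfCardEq hcard).symm
    have hinj : Function.Injective fun i => (e i : E) :=
      Subtype.val_injective.comp e.injective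
    obtain ⟨ε, hε, h⟩ := exists_pos_forall_two_mul_lt_dist hinj (c := fun i => c (e i))
      (fun i j hij hcc => hc _ (e i).2 _ (e j).2 (hinj.ne hij) hcc)
    have hu : ∀ i, ∃ v ∈ TopologicalSpace.countableBasis E,
        (e i : E) ∈ v ∧ v ⊆ Metric.ball (e i : E) ε := fun i =>
      (TopologicalSpace.isBasis_countableBasis E).exists_subset_of_mem_open
        (Metric.mem_ball_self hε) Metric.isOpen_ball
    choose v hv hev hvb using hu
    refine ⟨fun i => ⟨v i, hv i⟩, fun i => c (e i), ?_, fun i => ⟨e i, hSV (e i).2, hev i⟩⟩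
    intro i j hij x hx y hy
    obtain ⟨h1, h2⟩ := h i j hij
    have hx' : dist x (e i : E) < ε := hvb i hx
    have hy' : dist y (e j : E) < ε := hvb j hy
    have htri : dist (e i : E) (e j : E) ≤ dist x (e i : E) + dist x y + dist y (e j : E) := by
      rw [dist_comm x (e i : E)]
      exact dist_triangle4 _ _ _ _
    refine ⟨dist_pos.1 (by linarith), fun hcc => ?_⟩
    have := h2 hcc
    linarith
  · rintro ⟨u, c, hgood, hne⟩
    choose x hxV hxu using hne
    have hinj : Function.Injective x := by
      intro i j hij
      by_contra hne
      exact (hgood i j hne _ (hxu i) _ (hxu j)).1 hij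
    refine ⟨Finset.univ.image x, ?_, ⟨fun y => if h : ∃ i, x i = y then c h.choose else ⟨0, hk⟩, ?_⟩,
      ?_⟩
    · intro y hy
      simp only [Finset.coe_image, Finset.coe_univ, Set.image_univ, Set.mem_range] at hy
      obtain ⟨i, rfl⟩ := hy
      exact hxV i
    · intro y hy z hz hyz heq
      simp only [Finset.coe_image, Finset.coe_univ, Set.image_univ, Set.mem_range] at hy hz
      simp only [dif_pos hy, dif_pos hz] at heq
      have h1 := hy.choose_spec
      have h2 := hz.choose_spec
      rw [← h1, ← h2]
      exact (hgood _ _ (fun h => hyz (by rw [← h1, ← h2, h])) _ (hxu _) _ (hxu _)).2 heq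
    · rw [Finset.card_image_of_injective _ hinj, Finset.card_univ, Fintype.card_fin]

/-- The event that the value is at least `m` is a countable union of finite intersections of events
that a basic open set meets the process inside `B`. -/
theorem measurable_maxColored_inter
    (hfin : ∀ ω, ∀ B : Set (EuclideanSpace ℝ (Fin d)), Bornology.IsBounded B → (X ω ∩ B).Finite)
    (hk : 0 < k) {r : ℝ} {B : Set (EuclideanSpace ℝ (Fin d))} (hB : MeasurableSet B)
    (hb : Bornology.IsBounded B) :
    Measurable[countAlgebra X B] fun ω => maxColored k r (B ∩ X ω) := by
  refine @measurable_of_Ici _ _ _ _ _ (countAlgebra X B) _ _ _ _ fun m => ?_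
  have hset : (fun ω => maxColored k r (B ∩ X ω)) ⁻¹' Set.Ici m =
      ⋃ (u : Fin m → TopologicalSpace.countableBasis (EuclideanSpace ℝ (Fin d)))
        (c : Fin m → Fin k) (_ : ∀ i j, i ≠ j → ∀ x ∈ (u i : Set (EuclideanSpace ℝ (Fin d))),
          ∀ y ∈ (u j : Set (EuclideanSpace ℝ (Fin d))), x ≠ y ∧ (c i = c j → r < dist x y)),
        ⋂ i, (fun ω => (X ω ∩ (B ∩ u i)).ncard) ⁻¹' Set.Ioi 0 := by
    ext ω
    have hV : (B ∩ X ω).Finite := by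
      rw [Set.inter_comm]
      exact hfin ω B hb
    have hpos : ∀ v : Set (EuclideanSpace ℝ (Fin d)),
        0 < (X ω ∩ (B ∩ v)).ncard ↔ (B ∩ X ω ∩ v).Nonempty := by
      intro v
      rw [Set.ncard_pos (hfin ω _ (hb.subset Set.inter_subset_left)), ← Set.inter_assoc,
        Set.inter_comm B]
    simp only [Set.mem_preimage, Set.mem_Ici, le_maxColored_iff_exists_basis hk hV, Set.mem_iUnion,
      Set.mem_iInter, Set.mem_Ioi, hpos, exists_prop]
  rw [hset]
  have : Countable (TopologicalSpace.countableBasis (EuclideanSpace ℝ (Fin d))) :=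
    (TopologicalSpace.countable_countableBasis _).to_subtype
  refine MeasurableSet.iUnion fun u => MeasurableSet.iUnion fun c => MeasurableSet.iUnion fun _ =>
    MeasurableSet.iInter fun i => ?_
  exact measurable_ncard_countAlgebra (hB.inter
    (TopologicalSpace.isOpen_of_mem_countableBasis (u i).2).measurableSet)
    (hb.subset Set.inter_subset_left) Set.inter_subset_left measurableSet_Ioi

end Measurability

/-! ### Second moments of Poisson counts -/

section PoissonMoments

theorem memLp_two_cast_poissonMeasure (a : ℝ≥0) :
    MemLp (fun n : ℕ => (n : ℝ)) 2 (poissonMeasure a) := by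
  rw [memLp_two_iff_integrable_sq (by fun_prop), integrable_poissonMeasure_iff]
  refine Summable.of_nonneg_of_le (fun n => by positivity) (fun n => ?_)
    ((Real.summable_pow_div_factorial (4 * (a : ℝ))).mul_left (Real.exp (-a)))
  have h : (n : ℝ) ^ 2 ≤ 4 ^ n := by
    have h1 : (n : ℝ) ≤ 2 ^ n := by exact_mod_cast Nat.lt_two_pow_self.le
    calc (n : ℝ) ^ 2 ≤ (2 ^ n) ^ 2 := by gcongr
      _ = 4 ^ n := by rw [← pow_mul, mul_comm, pow_mul]; norm_num
  rw [Real.norm_of_nonneg (by positivity), mul_pow]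
  calc Real.exp (-a) * (a : ℝ) ^ n / n.factorial * (n : ℝ) ^ 2
      ≤ Real.exp (-a) * (a : ℝ) ^ n / n.factorial * 4 ^ n := by gcongr
    _ = Real.exp (-a) * (4 ^ n * (a : ℝ) ^ n / n.factorial) := by ring

variable {d : ℕ} {Ω : Type*} [MeasurableSpace Ω] {P : Measure Ω} {lam : ℝ}
  {X : Ω → Set (EuclideanSpace ℝ (Fin d))}

theorem IsPoissonProcess.memLp_count (hX : IsPoissonProcess lam X P)
    {B : Set (EuclideanSpace ℝ (Fin d))} (hB : MeasurableSet B) (hb : Bornology.IsBounded B) :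
    MemLp (fun ω => ((X ω ∩ B).ncard : ℝ)) 2 P := by
  have h := memLp_two_cast_poissonMeasure (lam * (volume B).toReal).toNNReal
  rw [← hX.map_count B hB hb] at h
  exact h.comp_of_map (hX.measurable_count B hB hb).aemeasurable

theorem IsPoissonProcess.integral_count (hX : IsPoissonProcess lam X P)
    {B : Set (EuclideanSpace ℝ (Fin d))} (hB : MeasurableSet B) (hb : Bornology.IsBounded B)
    (f : ℕ → ℝ) :
    ∫ ω, f (X ω ∩ B).ncard ∂P = ∫ n, f n ∂poissonMeasure (lam * (volume B).toReal).toNNReal := by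
  rw [← hX.map_count B hB hb, integral_map (hX.measurable_count B hB hb).aemeasurable
    (by fun_prop)]

end PoissonMoments

/-! ### Conditional expectation and the Efron–Stein step -/

section CondExp

variable {Ω : Type*} {m₁ m₁' m₂ m : MeasurableSpace Ω} {μ : Measure[m] Ω}

theorem isPiSystem_image2_inter_measurableSet (m₁ m₂ : MeasurableSpace Ω) :
    IsPiSystem (Set.image2 (· ∩ ·) {s | MeasurableSet[m₁] s} {s | MeasurableSet[m₂] s}) := by
  rintro _ ⟨A, hA, B, hB, rfl⟩ _ ⟨A', hA', B', hB', rfl⟩ -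
  exact ⟨A ∩ A', MeasurableSet.inter hA hA', B ∩ B', MeasurableSet.inter hB hB',
    Set.inter_inter_inter_comm _ _ _ _⟩

theorem sup_eq_generateFrom_image2_inter (m₁ m₂ : MeasurableSpace Ω) :
    m₁ ⊔ m₂ = MeasurableSpace.generateFrom
      (Set.image2 (· ∩ ·) {s | MeasurableSet[m₁] s} {s | MeasurableSet[m₂] s}) := by
  apply le_antisymm
  · refine sup_le (fun s hs => ?_) (fun s hs => ?_)
    · exact MeasurableSpace.measurableSet_generateFrom
        ⟨s, hs, Set.univ, MeasurableSet.univ, Set.inter_univ s⟩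
    · exact MeasurableSpace.measurableSet_generateFrom
        ⟨Set.univ, MeasurableSet.univ, s, hs, Set.univ_inter s⟩
  · refine MeasurableSpace.generateFrom_le ?_
    rintro _ ⟨A, hA, B, hB, rfl⟩
    exact MeasurableSet.inter ((le_sup_left : m₁ ≤ m₁ ⊔ m₂) A hA)
      ((le_sup_right : m₂ ≤ m₁ ⊔ m₂) B hB)

theorem setIntegral_inter_of_indep (hm₁ : m₁ ≤ m) (hm₂ : m₂ ≤ m) (h : Indep m₁ m₂ μ) {f : Ω → ℝ}
    (hf : StronglyMeasurable[m₁] f) {A B : Set Ω} (hA : MeasurableSet[m₁] A)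
    (hB : MeasurableSet[m₂] B) :
    ∫ x in A ∩ B, f x ∂μ = (∫ x in A, f x ∂μ) * μ.real B := by
  have hind : IndepFun (A.indicator f) (B.indicator fun _ => (1 : ℝ)) μ := by
    refine (IndepFun_iff_Indep _ _ _).2 (indep_of_indep_of_le_left (indep_of_indep_of_le_right h ?_) ?_)
    · exact measurable_iff_comap_le.1 (Measurable.indicator (@measurable_const _ _ _ m₂ _) hB)
    · exact measurable_iff_comap_le.1 (hf.measurable.indicator hA)
  have := hind.integral_fun_mul_eq_mul_integral
    ((hf.indicator hA).mono hm₁).aestronglyMeasurable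
    ((measurable_const.indicator (hm₂ B hB)).aestronglyMeasurable)
  have h1 : ∫ x, B.indicator (fun _ => (1 : ℝ)) x ∂μ = μ.real B :=
    integral_indicator_one (hm₂ B hB)
  rw [integral_indicator (hm₁ A hA), h1] at this
  rw [← this, ← integral_indicator ((hm₁ A hA).inter (hm₂ B hB))]
  congr 1 with x
  by_cases hxA : x ∈ A <;> by_cases hxB : x ∈ B <;> simp [hxA, hxB]

/-- Information independent of `m₁'` does not help to predict an `m₁'`-measurable `f`. On the
π-system of sets `A ∩ B`, both integrals factor as an integral over `A` times the measure of `B`. -/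
theorem condExp_sup_of_indep [IsProbabilityMeasure μ] (h₁ : m₁ ≤ m₁') (hm₁ : m₁' ≤ m)
    (hm₂ : m₂ ≤ m) (h : Indep m₁' m₂ μ) {f : Ω → ℝ} (hf : StronglyMeasurable[m₁'] f)
    (hint : Integrable f μ) : μ[f | m₁ ⊔ m₂] =ᵐ[μ] μ[f | m₁] := by
  have hsup : m₁ ⊔ m₂ ≤ m := sup_le (h₁.trans hm₁) hm₂
  have hsm : StronglyMeasurable[m₁ ⊔ m₂] (μ[f | m₁]) :=
    stronglyMeasurable_condExp.mono le_sup_left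
  refine (ae_eq_condExp_of_forall_setIntegral_eq hsup hint
    (fun s _ _ => integrable_condExp.integrableOn) (fun s hs _ => ?_)
    hsm.aestronglyMeasurable).symm
  refine MeasurableSpace.induction_on_inter
    (C := fun s _ => ∫ x in s, (μ[f | m₁]) x ∂μ = ∫ x in s, f x ∂μ)
    (sup_eq_generateFrom_image2_inter m₁ m₂) (isPiSystem_image2_inter_measurableSet m₁ m₂)
    (by simp) ?_ ?_ ?_ s hs
  · rintro _ ⟨A, hA, B, hB, rfl⟩
    simp only
    rw [setIntegral_inter_of_indep hm₁ hm₂ h hf (h₁ A hA) hB,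
      setIntegral_inter_of_indep hm₁ hm₂ h (stronglyMeasurable_condExp.mono h₁) (h₁ A hA) hB,
      setIntegral_condExp (h₁.trans hm₁) hint hA]
  · intro t ht hC
    have e1 := integral_add_compl (hsup t ht) (integrable_condExp (f := f) (m := m₁) (μ := μ))
    have e2 := integral_add_compl (hsup t ht) hint
    rw [integral_condExp (h₁.trans hm₁)] at e1
    linarith
  · intro g hdisj hg hC
    rw [integral_iUnion (fun i => hsup _ (hg i)) hdisj integrable_condExp.integrableOn,
      integral_iUnion (fun i => hsup _ (hg i)) hdisj hint.integrableOn]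
    exact tsum_congr hC

theorem integral_condVar_eq (hm₁ : m₁ ≤ m) [IsFiniteMeasure μ] (f : Ω → ℝ) :
    ∫ x, (Var[f; μ | m₁]) x ∂μ = ∫ x, (f x - (μ[f | m₁]) x) ^ 2 ∂μ := by
  unfold condVar
  rw [integral_condExp hm₁]
  rfl

theorem variance_condExp_le [IsProbabilityMeasure μ] (hm₁ : m₁ ≤ m) {f : Ω → ℝ}
    (hf : MemLp f 2 μ) : Var[μ[f | m₁]; μ] ≤ Var[f; μ] := by
  rw [← integral_condVar_add_variance_condExp hm₁ hf, integral_condVar_eq hm₁]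
  have : 0 ≤ ∫ x, (f x - (μ[f | m₁]) x) ^ 2 ∂μ := integral_nonneg fun x => sq_nonneg _
  linarith

/-- One step of the Efron–Stein inequality. -/
theorem variance_condExp_sup_le [IsProbabilityMeasure μ] (h₁ : m₁ ≤ m₁') (hm₁ : m₁' ≤ m)
    (hm₂ : m₂ ≤ m) (h : Indep m₁' m₂ μ) {f g : Ω → ℝ} (hf : MemLp f 2 μ) (hg : MemLp g 2 μ)
    (hgm : StronglyMeasurable[m₁'] g) :
    Var[μ[f | m₁ ⊔ m₂]; μ] ≤ Var[μ[f | m₁]; μ] + ∫ x, (f x - g x) ^ 2 ∂μ := by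
  have hm₁₀ : m₁ ≤ m := h₁.trans hm₁
  have hsup : m₁ ⊔ m₂ ≤ m := sup_le hm₁₀ hm₂
  have hfi := hf.integrable one_le_two
  have hgi := hg.integrable one_le_two
  have hfg : MemLp (f - g) 2 μ := hf.sub hg
  have hX : MemLp (μ[f | m₁ ⊔ m₂]) 2 μ := hf.condExp one_le_two
  have hY : MemLp (μ[f - g | m₁ ⊔ m₂]) 2 μ := hfg.condExp one_le_two
  have e1 : μ[μ[f | m₁ ⊔ m₂] | m₁] =ᵐ[μ] μ[f | m₁] := condExp_condExp_of_le le_sup_left hsup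
  have e2 : μ[μ[f - g | m₁ ⊔ m₂] | m₁] =ᵐ[μ] μ[f - g | m₁] :=
    condExp_condExp_of_le le_sup_left hsup
  have e3 : μ[f - g | m₁ ⊔ m₂] =ᵐ[μ] μ[f | m₁ ⊔ m₂] - μ[g | m₁ ⊔ m₂] := condExp_sub hfi hgi _
  have e4 : μ[f - g | m₁] =ᵐ[μ] μ[f | m₁] - μ[g | m₁] := condExp_sub hfi hgi _
  have e5 : μ[g | m₁ ⊔ m₂] =ᵐ[μ] μ[g | m₁] := condExp_sup_of_indep h₁ hm₁ hm₂ h hgm hgi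
  -- Conditioning `g` on `m₂` as well adds nothing, so subtracting `g` leaves the increment from
  -- `m₁` to `m₁ ⊔ m₂` unchanged. Total variance then bounds this increment by the second moment of
  -- `f - g`.
  have key : ∫ x, (Var[μ[f | m₁ ⊔ m₂]; μ | m₁]) x ∂μ =
      ∫ x, (Var[μ[f - g | m₁ ⊔ m₂]; μ | m₁]) x ∂μ := by
    rw [integral_condVar_eq hm₁₀, integral_condVar_eq hm₁₀]
    refine integral_congr_ae ?_
    filter_upwards [e1, e2, e3, e4, e5] with x h1 h2 h3 h4 h5
    rw [h1, h2, h3, h4]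
    simp only [Pi.sub_apply]
    rw [h5]
    ring
  have t1 := integral_condVar_add_variance_condExp hm₁₀ hX
  have t2 := integral_condVar_add_variance_condExp hm₁₀ hY
  have t3 : Var[μ[f - g | m₁ ⊔ m₂]; μ] ≤ Var[f - g; μ] := variance_condExp_le hsup hfg
  have t4 : Var[f - g; μ] ≤ ∫ x, (f x - g x) ^ 2 ∂μ :=
    variance_le_expectation_sq hfg.aestronglyMeasurable
  have t5 := variance_nonneg (μ[μ[f - g | m₁ ⊔ m₂] | m₁]) μ
  rw [variance_congr e1] at t1
  linarith

end CondExp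

/-! ### Unit cells covering the cube -/

section Grid

variable {d : ℕ}

theorem isCompact_setOf_forall_mem_Icc (a b : Fin d → ℝ) :
    IsCompact {x : EuclideanSpace ℝ (Fin d) | ∀ i, x i ∈ Set.Icc (a i) (b i)} := by
  have h : IsCompact (Set.Icc a b) := isCompact_Icc
  have h' := (EuclideanSpace.equiv (Fin d) ℝ).toHomeomorph.isCompact_preimage.2 h
  convert h' using 1
  ext x
  simp only [Set.mem_ofPred_eq, Set.mem_preimage, Set.mem_Icc, Pi.le_def, ← forall_and]
  rfl

theorem isCompact_cube (t : ℝ) : IsCompact (cube d t) :=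
  isCompact_setOf_forall_mem_Icc (fun _ => 0) fun _ => t

/-- The half-open unit cube with lower corner `z`. -/
def gridCell (z : Fin d → ℤ) : Set (EuclideanSpace ℝ (Fin d)) :=
  {x | ∀ i, ⌊x i⌋ = z i}

theorem measurableSet_gridCell (z : Fin d → ℤ) : MeasurableSet (gridCell z) := by
  have h : gridCell z = ⋂ i, (fun x : EuclideanSpace ℝ (Fin d) => ⌊x i⌋) ⁻¹' {z i} := by
    ext x
    simp [gridCell]
  rw [h]
  refine MeasurableSet.iInter fun i => ?_
  have hm : Measurable fun x : EuclideanSpace ℝ (Fin d) => x i := by fun_prop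
  exact hm.floor (measurableSet_singleton _)

theorem isBounded_gridCell (z : Fin d → ℤ) : Bornology.IsBounded (gridCell z) := by
  refine (isCompact_setOf_forall_mem_Icc (fun i => (z i : ℝ)) fun i => z i + 1).isBounded.subset ?_
  intro x hx i
  rw [← hx i]
  exact ⟨Int.floor_le _, (Int.lt_floor_add_one _).le⟩

theorem volume_gridCell (z : Fin d → ℤ) :
    volume (gridCell z) = volume (gridCell (0 : Fin d → ℤ)) := by
  have h : gridCell z =
      (fun x => x + WithLp.toLp 2 fun i => -(z i : ℝ)) ⁻¹' gridCell (0 : Fin d → ℤ) := by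
    ext x
    simp only [gridCell, Set.mem_ofPred_eq, Set.mem_preimage, PiLp.add_apply, Pi.zero_apply,
      ← sub_eq_add_neg, Int.floor_sub_intCast, sub_eq_zero]
  rw [h, measure_preimage_add_right]

theorem disjoint_gridCell {z w : Fin d → ℤ} (h : z ≠ w) :
    Disjoint (gridCell z) (gridCell w) :=
  Set.disjoint_left.2 fun _ hx hx' => h (funext fun i => (hx i).symm.trans (hx' i))

theorem cube_subset_iUnion_gridCell (t : ℝ) :
    cube d t ⊆ ⋃ z ∈ Fintype.piFinset fun _ : Fin d => Finset.Icc 0 ⌊t⌋, gridCell z := by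
  intro x hx
  refine Set.mem_iUnion₂.2 ⟨fun i => ⌊x i⌋, ?_, fun i => rfl⟩
  simp only [Fintype.mem_piFinset, Finset.mem_Icc]
  exact fun i => ⟨Int.floor_nonneg.2 (hx i).1, Int.floor_le_floor (hx i).2⟩

end Grid

/-! ### Upper bound on the variance -/

section UpperBound

variable {d k : ℕ} {Ω : Type*} [mΩ : MeasurableSpace Ω] {P : Measure Ω}
  {lam : ℝ} {X : Ω → Set (EuclideanSpace ℝ (Fin d))}

theorem IsPoissonProcess.finite_inter (hX : IsPoissonProcess lam X P)
    {B : Set (EuclideanSpace ℝ (Fin d))} (hb : Bornology.IsBounded B) (ω : Ω) :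
    (B ∩ X ω).Finite := by
  rw [Set.inter_comm]
  exact hX.locallyFinite ω B hb

theorem IsPoissonProcess.measurable_maxColored (hX : IsPoissonProcess lam X P) (hk : 0 < k)
    {r : ℝ} {B : Set (EuclideanSpace ℝ (Fin d))} (hB : MeasurableSet B)
    (hb : Bornology.IsBounded B) :
    Measurable[countAlgebra X B] fun ω => (maxColored k r (B ∩ X ω) : ℝ) :=
  measurable_from_nat.comp (measurable_maxColored_inter hX.locallyFinite hk hB hb)

theorem IsPoissonProcess.memLp_maxColored (hX : IsPoissonProcess lam X P) (hk : 0 < k)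
    {r : ℝ} {B : Set (EuclideanSpace ℝ (Fin d))} (hB : MeasurableSet B)
    (hb : Bornology.IsBounded B) :
    MemLp (fun ω => (maxColored k r (B ∩ X ω) : ℝ)) 2 P := by
  refine (hX.memLp_count hB hb).mono
    ((hX.measurable_maxColored hk hB hb).mono (hX.countAlgebra_le B) le_rfl).aestronglyMeasurable
    (ae_of_all _ fun ω => ?_)
  rw [Real.norm_natCast, Real.norm_natCast, Set.inter_comm (X ω)]
  exact_mod_cast maxColored_le_ncard hk (hX.finite_inter hb ω)

theorem IsPoissonProcess.integral_sq_maxColored_sub_le (hX : IsPoissonProcess lam X P)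
    (hk : 0 < k) {r : ℝ} {B Q : Set (EuclideanSpace ℝ (Fin d))} (hB : MeasurableSet B)
    (hb : Bornology.IsBounded B) (hQ : MeasurableSet Q) (hQb : Bornology.IsBounded Q) :
    ∫ ω, ((maxColored k r (B ∩ X ω) : ℝ) - maxColored k r ((B \ Q) ∩ X ω)) ^ 2 ∂P ≤
      ∫ n, (n : ℝ) ^ 2 ∂poissonMeasure (lam * (volume Q).toReal).toNNReal := by
  rw [← hX.integral_count hQ hQb fun n => (n : ℝ) ^ 2]
  refine integral_mono ((hX.memLp_maxColored hk hB hb).sub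
    (hX.memLp_maxColored hk (hB.diff hQ) (hb.subset Set.sdiff_subset))).integrable_sq
    (hX.memLp_count hQ hQb).integrable_sq fun ω => ?_
  have hfin := hX.finite_inter hb ω
  have hsub : (B \ Q) ∩ X ω ⊆ B ∩ X ω := Set.inter_subset_inter_left _ Set.sdiff_subset
  have h1 : (maxColored k r ((B \ Q) ∩ X ω) : ℝ) ≤ maxColored k r (B ∩ X ω) := by
    exact_mod_cast maxColored_mono hk hfin hsub
  have h2 : (maxColored k r (B ∩ X ω) : ℝ) ≤
      maxColored k r ((B \ Q) ∩ X ω) + (X ω ∩ Q).ncard := by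
    have h3 : ((B ∩ X ω) \ ((B \ Q) ∩ X ω)).ncard ≤ (X ω ∩ Q).ncard := by
      refine Set.ncard_le_ncard ?_ (hX.locallyFinite ω Q hQb)
      rintro x ⟨⟨hxB, hxX⟩, hx⟩
      exact ⟨hxX, by_contra fun hxQ => hx ⟨⟨hxB, hxQ⟩, hxX⟩⟩
    exact_mod_cast (maxColored_le_add_ncard_diff hk hfin hsub).trans (Nat.add_le_add_left h3 _)
  simp only
  exact pow_le_pow_left₀ (by linarith) (by linarith) 2

theorem IsPoissonProcess.variance_condExp_biUnion_le [IsProbabilityMeasure P]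
    (hX : IsPoissonProcess lam X P)
    (hk : 0 < k) {r : ℝ} {B : Set (EuclideanSpace ℝ (Fin d))} (hB : MeasurableSet B)
    (hb : Bornology.IsBounded B) (s : Finset (Fin d → ℤ)) :
    Var[P[fun ω => (maxColored k r (B ∩ X ω) : ℝ) | countAlgebra X (⋃ z ∈ s, gridCell z)]; P] ≤
      s.card * ∫ n, (n : ℝ) ^ 2
        ∂poissonMeasure (lam * (volume (gridCell (0 : Fin d → ℤ))).toReal).toNNReal := by
  classical
  induction s using Finset.induction_on with
  | empty =>
    have h : countAlgebra X (⋃ z ∈ (∅ : Finset (Fin d → ℤ)), gridCell z) = ⊥ := by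
      rw [← countAlgebra_empty (X := X)]
      simp
    rw [h, condExp_bot, ← covariance_self aemeasurable_const, covariance_const_left]
    simp
  | insert a s ha ih =>
    have hm : MeasurableSet (⋃ z ∈ s, gridCell z) :=
      Finset.measurableSet_biUnion s fun z _ => measurableSet_gridCell z
    have hU : (⋃ z ∈ s, gridCell z) ⊆ (gridCell a)ᶜ := by
      refine Set.iUnion₂_subset fun z hz => Set.subset_compl_iff_disjoint_right.2
        (disjoint_gridCell ?_)
      rintro rfl
      exact ha hz
    have hsup : countAlgebra X (⋃ z ∈ insert a s, gridCell z) =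
        countAlgebra X (⋃ z ∈ s, gridCell z) ⊔ countAlgebra X (gridCell a) := by
      rw [Finset.set_biUnion_insert, Set.union_comm]
      exact le_antisymm (countAlgebra_union_le hX.locallyFinite hm)
        (sup_le (countAlgebra_mono Set.subset_union_left)
          (countAlgebra_mono Set.subset_union_right))
    have hBa := hB.diff (measurableSet_gridCell a)
    have hba : Bornology.IsBounded (B \ gridCell a) := hb.subset Set.sdiff_subset
    -- The comparison variable is the colored count of `B \ gridCell a`. It also depends on
    -- unrevealed cells, so the larger algebra is that of the whole complement of `gridCell a`.
    have hstep := variance_condExp_sup_le (countAlgebra_mono (X := X) hU) (hX.countAlgebra_le _)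
      (hX.countAlgebra_le _) (hX.indep_countAlgebra (disjoint_compl_left (a := gridCell a)))
      (hX.memLp_maxColored hk (r := r) hB hb) (hX.memLp_maxColored hk (r := r) hBa hba)
      (((hX.measurable_maxColored hk hBa hba).mono
        (countAlgebra_mono fun x hx => hx.2) le_rfl).stronglyMeasurable)
    have hsq := hX.integral_sq_maxColored_sub_le hk (r := r) hB hb (measurableSet_gridCell a)
      (isBounded_gridCell a)
    rw [volume_gridCell a] at hsq
    rw [hsup, Finset.card_insert_of_notMem ha]
    push_cast
    linarith

theorem IsPoissonProcess.variance_maxColored_cube_le [IsProbabilityMeasure P]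
    (hX : IsPoissonProcess lam X P)
    (hk : 0 < k) {r t : ℝ} (ht : 1 ≤ t) :
    Var[fun ω => (maxColored k r (cube d t ∩ X ω) : ℝ); P] ≤
      2 ^ d * (∫ n, (n : ℝ) ^ 2
        ∂poissonMeasure (lam * (volume (gridCell (0 : Fin d → ℤ))).toReal).toNNReal) * t ^ d := by
  have hB := (isCompact_cube (d := d) t).measurableSet
  have hb := (isCompact_cube (d := d) t).isBounded
  have h := hX.variance_condExp_biUnion_le hk (r := r) hB hb
    (Fintype.piFinset fun _ : Fin d => Finset.Icc 0 ⌊t⌋)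
  have hsm : StronglyMeasurable[countAlgebra X
      (⋃ z ∈ Fintype.piFinset fun _ : Fin d => Finset.Icc 0 ⌊t⌋, gridCell z)]
      fun ω => (maxColored k r (cube d t ∩ X ω) : ℝ) :=
    ((hX.measurable_maxColored hk hB hb).mono
      (countAlgebra_mono (cube_subset_iUnion_gridCell t)) le_rfl).stronglyMeasurable
  rw [condExp_of_stronglyMeasurable (hX.countAlgebra_le _) hsm
    ((hX.memLp_maxColored hk hB hb).integrable one_le_two)] at h
  refine h.trans ?_
  have hfloor : (0 : ℤ) ≤ ⌊t⌋ + 1 := by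
    have := Int.floor_nonneg.2 (zero_le_one.trans ht)
    omega
  -- There are `⌊t⌋ + 1 ≤ 2 * t` cells per coordinate, because `t ≥ 1`.
  have hcard : (((Fintype.piFinset fun _ : Fin d => Finset.Icc 0 ⌊t⌋).card : ℕ) : ℝ) ≤
      (2 * t) ^ d := by
    rw [Fintype.card_piFinset_const, Int.card_Icc, sub_zero, Nat.cast_pow]
    have h1 : (((⌊t⌋ + 1).toNat : ℕ) : ℝ) = (⌊t⌋ : ℝ) + 1 := by
      exact_mod_cast congrArg (Int.cast : ℤ → ℝ) (Int.toNat_of_nonneg hfloor)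
    have h2 := Int.floor_le t
    exact pow_le_pow_left₀ (Nat.cast_nonneg _) (by rw [h1]; linarith) d
  have hI : 0 ≤ ∫ n, (n : ℝ) ^ 2
      ∂poissonMeasure (lam * (volume (gridCell (0 : Fin d → ℤ))).toReal).toNNReal :=
    integral_nonneg fun n => sq_nonneg _
  calc _ ≤ (2 * t) ^ d * _ := mul_le_mul_of_nonneg_right hcard hI
    _ = _ := by rw [mul_pow]; ring

end UpperBound

/-! ### Lower bound: isolated clusters as test variables -/

section LowerBound

/-- With `n = s.card`, expanding gives `0 ≤ Var(F - ∑ T) = Var F - 2nσ + nσ`. -/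
theorem card_mul_le_variance_of_indep {Ω ι : Type*} [MeasurableSpace Ω] {P : Measure Ω}
    [IsProbabilityMeasure P] {F : Ω → ℝ} {T : ι → Ω → ℝ} {s : Finset ι} {σ : ℝ}
    (hF : MemLp F 2 P) (hT : ∀ i ∈ s, MemLp (T i) 2 P)
    (hind : Set.Pairwise (s : Set ι) fun i j => IndepFun (T i) (T j) P)
    (hvar : ∀ i ∈ s, Var[T i; P] = σ) (hcov : ∀ i ∈ s, cov[F, T i; P] = σ) :
    s.card * σ ≤ Var[F; P] := by
  have h1 := variance_sub hF (memLp_finsetSum' s hT)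
  rw [covariance_sum_right' hT hF, IndepFun.variance_sum hT hind, Finset.sum_congr rfl hvar,
    Finset.sum_congr rfl hcov, Finset.sum_const, nsmul_eq_mul] at h1
  have h2 := variance_nonneg (F - ∑ i ∈ s, T i) P
  linarith

/-- As `k ≥ 1`, the truncated count takes the distinct values `0` and `1` at atoms of positive mass,
so it is not almost surely `c`. -/
theorem integral_sq_min_sub_pos {a : ℝ≥0} (ha : 0 < a) {k : ℕ} (hk : 0 < k) (c : ℝ) :
    0 < ∫ n : ℕ, ((min n k : ℕ) - c : ℝ) ^ 2 ∂poissonMeasure a := by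
  have hint : Integrable (fun n : ℕ => ((min n k : ℕ) - c : ℝ) ^ 2) (poissonMeasure a) := by
    refine (MemLp.of_bound (by fun_prop) (k + |c|) (ae_of_all _ fun n => ?_)).integrable_sq
    refine (norm_sub_le _ _).trans (add_le_add ?_ le_rfl)
    rw [Real.norm_natCast]
    exact_mod_cast min_le_right n k
  refine lt_of_le_of_ne (integral_nonneg fun n => sq_nonneg _) fun h => ?_
  have hae := (integral_eq_zero_iff_of_nonneg (fun n => sq_nonneg _) hint).1 h.symm
  have hall : ∀ n : ℕ, ((min n k : ℕ) : ℝ) = c := by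
    intro n
    by_contra hn
    have hzero : poissonMeasure a {n} = 0 := by
      refine measure_mono_null ?_ hae
      rintro _ rfl
      simpa [sub_eq_zero] using hn
    have hpos := poissonMeasure_real_singleton_pos n ha
    rw [measureReal_def, hzero] at hpos
    simp at hpos
  have h0 := hall 0
  have h1 := hall 1
  rw [← h0, min_eq_left hk] at h1
  simp at h1

theorem integral_indicator_zero_poissonMeasure_pos (b : ℝ≥0) :
    0 < ∫ n : ℕ, (if n = 0 then (1 : ℝ) else 0) ∂poissonMeasure b := by
  have h : (fun n : ℕ => if n = 0 then (1 : ℝ) else 0) = ({0} : Set ℕ).indicator 1 := by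
    funext n
    simp [Set.indicator_apply]
  rw [h, integral_indicator_one (measurableSet_singleton 0), poissonMeasure_real_singleton]
  simp [Real.exp_pos]

variable {d k : ℕ} {Ω : Type*} {X : Ω → Set (EuclideanSpace ℝ (Fin d))}

/-- The indicator of the event that `A` contains no point of `X`. -/
noncomputable def vacant (X : Ω → Set (EuclideanSpace ℝ (Fin d)))
    (A : Set (EuclideanSpace ℝ (Fin d))) (ω : Ω) : ℝ :=
  if (X ω ∩ A).ncard = 0 then 1 else 0

/-- The deviation from `c` of the number of points of `X` in `q`, truncated at `k`. -/
noncomputable def truncDev (X : Ω → Set (EuclideanSpace ℝ (Fin d))) (k : ℕ) (c : ℝ)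
    (q : Set (EuclideanSpace ℝ (Fin d))) (ω : Ω) : ℝ :=
  (min (X ω ∩ q).ncard k : ℕ) - c

theorem norm_vacant_le (A : Set (EuclideanSpace ℝ (Fin d))) (ω : Ω) : ‖vacant X A ω‖ ≤ 1 := by
  unfold vacant
  split_ifs <;> simp

theorem norm_truncDev_le (c : ℝ) (q : Set (EuclideanSpace ℝ (Fin d))) (ω : Ω) :
    ‖truncDev X k c q ω‖ ≤ k + |c| := by
  refine (norm_sub_le _ _).trans (add_le_add ?_ le_rfl)
  rw [Real.norm_natCast]
  exact_mod_cast min_le_right _ k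

theorem measurable_vacant {A B : Set (EuclideanSpace ℝ (Fin d))} (hA : MeasurableSet A)
    (hb : Bornology.IsBounded A) (hAB : A ⊆ B) : Measurable[countAlgebra X B] (vacant X A) :=
  (measurable_from_nat (f := fun n => if n = 0 then (1 : ℝ) else 0)).comp
    (measurable_ncard_countAlgebra hA hb hAB)

theorem measurable_truncDev (c : ℝ) {q B : Set (EuclideanSpace ℝ (Fin d))} (hq : MeasurableSet q)
    (hb : Bornology.IsBounded q) (hqB : q ⊆ B) :
    Measurable[countAlgebra X B] (truncDev X k c q) :=
  (measurable_from_nat (f := fun n => ((min n k : ℕ) : ℝ) - c)).comp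
    (measurable_ncard_countAlgebra hq hb hqB)

variable [mΩ : MeasurableSpace Ω] {P : Measure Ω} {lam : ℝ}

theorem IsPoissonProcess.indepFun [IsProbabilityMeasure P] (hX : IsPoissonProcess lam X P)
    {B C : Set (EuclideanSpace ℝ (Fin d))} (hBC : Disjoint B C) {f g : Ω → ℝ}
    (hf : Measurable[countAlgebra X B] f) (hg : Measurable[countAlgebra X C] g) :
    IndepFun f g P :=
  (IndepFun_iff_Indep _ _ _).2 (indep_of_indep_of_le_left (indep_of_indep_of_le_right
    (hX.indep_countAlgebra hBC) (measurable_iff_comap_le.1 hg)) (measurable_iff_comap_le.1 hf))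

theorem IsPoissonProcess.integral_mul [IsProbabilityMeasure P] (hX : IsPoissonProcess lam X P)
    {B C : Set (EuclideanSpace ℝ (Fin d))} (hBC : Disjoint B C) {f g : Ω → ℝ}
    (hf : Measurable[countAlgebra X B] f) (hg : Measurable[countAlgebra X C] g) :
    ∫ ω, f ω * g ω ∂P = (∫ ω, f ω ∂P) * ∫ ω, g ω ∂P :=
  (hX.indepFun hBC hf hg).integral_fun_mul_eq_mul_integral
    (hf.mono (hX.countAlgebra_le B) le_rfl).aestronglyMeasurable
    (hg.mono (hX.countAlgebra_le C) le_rfl).aestronglyMeasurable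

theorem IsPoissonProcess.memLp_vacant_mul_truncDev [IsProbabilityMeasure P]
    (hX : IsPoissonProcess lam X P) (c : ℝ)
    {A q : Set (EuclideanSpace ℝ (Fin d))} (hA : MeasurableSet A) (hAb : Bornology.IsBounded A)
    (hq : MeasurableSet q) (hqb : Bornology.IsBounded q) :
    MemLp (fun ω => vacant X A ω * truncDev X k c q ω) 2 P := by
  refine MemLp.of_bound ?_ (k + |c|) (ae_of_all _ fun ω => ?_)
  · exact (((measurable_vacant hA hAb le_rfl).mono (hX.countAlgebra_le _) le_rfl).mul
      ((measurable_truncDev c hq hqb le_rfl).mono (hX.countAlgebra_le _) le_rfl)).aestronglyMeasurable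
  · rw [norm_mul]
    exact (mul_le_mul (norm_vacant_le A ω) (norm_truncDev_le c q ω) (norm_nonneg _)
      zero_le_one).trans (one_mul _).le

/-- If `q` has diameter at most `r` and is separated by `A` from the rest of `B`, then on the
event that `A` is vacant the points in `q` contribute `min k` of their number. -/
theorem IsPoissonProcess.vacant_mul_maxColored (hX : IsPoissonProcess lam X P) (hk : 0 < k)
    {r : ℝ} (hr : 0 ≤ r) (c : ℝ) {A B q : Set (EuclideanSpace ℝ (Fin d))}
    (hb : Bornology.IsBounded B) (hAB : A ⊆ B) (hqB : q ⊆ B)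
    (hdiam : ∀ x ∈ q, ∀ y ∈ q, dist x y ≤ r)
    (hsep : ∀ x ∈ q, ∀ y ∈ B \ (A ∪ q), r < dist x y) (ω : Ω) :
    vacant X A ω * maxColored k r (B ∩ X ω) =
      vacant X A ω * (maxColored k r ((B \ (A ∪ q)) ∩ X ω) + truncDev X k c q ω + c) := by
  unfold vacant truncDev
  split_ifs with h
  · have hempty : X ω ∩ A = ∅ :=
      (Set.ncard_eq_zero (hX.locallyFinite ω A (hb.subset hAB))).1 h
    have hunion : B ∩ X ω = ((B \ (A ∪ q)) ∩ X ω) ∪ (X ω ∩ q) := by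
      ext x
      constructor
      · rintro ⟨hxB, hxX⟩
        by_cases hxq : x ∈ q
        · exact Or.inr ⟨hxX, hxq⟩
        · refine Or.inl ⟨⟨hxB, ?_⟩, hxX⟩
          rintro (hxA | hxq')
          · exact (hempty ▸ (⟨hxX, hxA⟩ : x ∈ X ω ∩ A) : x ∈ (∅ : Set _))
          · exact hxq hxq'
      · rintro (⟨hx, hxX⟩ | ⟨hxX, hxq⟩)
        · exact ⟨hx.1, hxX⟩
        · exact ⟨hqB hxq, hxX⟩
    rw [hunion, maxColored_union_of_separated hk hr
      (hX.finite_inter (hb.subset Set.sdiff_subset) ω) (hX.locallyFinite ω q (hb.subset hqB)),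
      maxColored_of_dist_le hk (hX.locallyFinite ω q (hb.subset hqB))
        fun x hx y hy => hdiam x hx.2 y hy.2]
    · push_cast
      ring
    · intro x hx y hy
      rw [dist_comm]
      exact hsep y hy.2 x hx.1
  · simp

variable [IsProbabilityMeasure P]

theorem IsPoissonProcess.integral_vacant_mul_truncDev (hX : IsPoissonProcess lam X P) {c : ℝ}
    {A q : Set (EuclideanSpace ℝ (Fin d))} (hA : MeasurableSet A) (hAb : Bornology.IsBounded A)
    (hq : MeasurableSet q) (hqb : Bornology.IsBounded q) (hAq : Disjoint A q)
    (hc : ∫ ω, truncDev X k c q ω ∂P = 0) : ∫ ω, vacant X A ω * truncDev X k c q ω ∂P = 0 := by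
  rw [hX.integral_mul hAq (measurable_vacant hA hAb le_rfl)
    (measurable_truncDev c hq hqb le_rfl), hc, mul_zero]

theorem IsPoissonProcess.variance_vacant_mul_truncDev (hX : IsPoissonProcess lam X P) {c : ℝ}
    {A q : Set (EuclideanSpace ℝ (Fin d))} (hA : MeasurableSet A) (hAb : Bornology.IsBounded A)
    (hq : MeasurableSet q) (hqb : Bornology.IsBounded q) (hAq : Disjoint A q)
    (hc : ∫ ω, truncDev X k c q ω ∂P = 0) :
    Var[fun ω => vacant X A ω * truncDev X k c q ω; P] =
      (∫ ω, vacant X A ω ∂P) * ∫ ω, truncDev X k c q ω ^ 2 ∂P := by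
  rw [variance_eq_sub (hX.memLp_vacant_mul_truncDev c hA hAb hq hqb),
    hX.integral_vacant_mul_truncDev hA hAb hq hqb hAq hc]
  rw [← hX.integral_mul hAq (measurable_vacant hA hAb le_rfl)
    ((measurable_truncDev c hq hqb le_rfl).pow_const 2)]
  rw [zero_pow two_ne_zero, sub_zero]
  congr 1 with ω
  simp only [Pi.pow_apply, vacant]
  split_ifs <;> simp

/-- On vacancy of `A`, the count is that of `B \ (A ∪ q)`, plus the centered core count, plus `c`.
Against the test variable, the first and last terms integrate to zero by independence from `q`; only
the square of the core term remains. -/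
theorem IsPoissonProcess.covariance_maxColored_vacant_mul_truncDev
    (hX : IsPoissonProcess lam X P) (hk : 0 < k) {r : ℝ} (hr : 0 ≤ r) {c : ℝ}
    {A B q : Set (EuclideanSpace ℝ (Fin d))} (hB : MeasurableSet B) (hb : Bornology.IsBounded B)
    (hA : MeasurableSet A) (hq : MeasurableSet q) (hAB : A ⊆ B) (hqB : q ⊆ B)
    (hAq : Disjoint A q) (hdiam : ∀ x ∈ q, ∀ y ∈ q, dist x y ≤ r)
    (hsep : ∀ x ∈ q, ∀ y ∈ B \ (A ∪ q), r < dist x y)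
    (hc : ∫ ω, truncDev X k c q ω ∂P = 0) :
    cov[fun ω => (maxColored k r (B ∩ X ω) : ℝ), fun ω => vacant X A ω * truncDev X k c q ω; P] =
      (∫ ω, vacant X A ω ∂P) * ∫ ω, truncDev X k c q ω ^ 2 ∂P := by
  have hAb := hb.subset hAB
  have hqb := hb.subset hqB
  have hR := hB.diff (hA.union hq)
  have hRb : Bornology.IsBounded (B \ (A ∪ q)) := hb.subset Set.sdiff_subset
  have hT := hX.memLp_vacant_mul_truncDev (k := k) c hA hAb hq hqb
  have hT0 := hX.integral_vacant_mul_truncDev hA hAb hq hqb hAq hc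
  have hG := hX.memLp_maxColored hk (r := r) hR hRb
  have hV : MemLp (truncDev X k c q) 2 P := MemLp.of_bound
    ((measurable_truncDev c hq hqb le_rfl).mono (hX.countAlgebra_le _) le_rfl).aestronglyMeasurable
    (k + |c|) (ae_of_all _ fun ω => norm_truncDev_le c q ω)
  rw [covariance_eq_sub (hX.memLp_maxColored hk hB hb) hT, hT0, mul_zero, sub_zero]
  have hpt : ∀ ω, ((fun ω => (maxColored k r (B ∩ X ω) : ℝ)) *
      fun ω => vacant X A ω * truncDev X k c q ω) ω =
      vacant X A ω * maxColored k r ((B \ (A ∪ q)) ∩ X ω) * truncDev X k c q ω +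
        (truncDev X k c q ω * (vacant X A ω * truncDev X k c q ω) +
          c * (vacant X A ω * truncDev X k c q ω)) := by
    intro ω
    have h := hX.vacant_mul_maxColored hk hr c hb hAB hqB hdiam hsep ω
    simp only [Pi.mul_apply]
    linear_combination truncDev X k c q ω * h
  have hi1 : Integrable (fun ω => vacant X A ω * maxColored k r ((B \ (A ∪ q)) ∩ X ω) *
      truncDev X k c q ω) P := by
    refine (hG.integrable_mul hT).congr (ae_of_all _ fun ω => ?_)
    simp only [Pi.mul_apply]
    ring
  have hi2 : Integrable (fun ω => truncDev X k c q ω * (vacant X A ω * truncDev X k c q ω)) P :=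
    hV.integrable_mul hT
  have hi3 : Integrable (fun ω => c * (vacant X A ω * truncDev X k c q ω)) P :=
    (hT.integrable one_le_two).const_mul c
  have hi23 : Integrable (fun ω => truncDev X k c q ω * (vacant X A ω * truncDev X k c q ω) +
      c * (vacant X A ω * truncDev X k c q ω)) P := hi2.add hi3
  rw [integral_congr_ae (ae_of_all _ hpt), integral_add hi1 hi23, integral_add hi2 hi3,
    integral_const_mul, hT0, mul_zero, add_zero]
  have hz : ∫ ω, vacant X A ω * maxColored k r ((B \ (A ∪ q)) ∩ X ω) * truncDev X k c q ω ∂P =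
      0 := by
    rw [hX.integral_mul (B := qᶜ) (f := fun ω => vacant X A ω *
      maxColored k r ((B \ (A ∪ q)) ∩ X ω)) disjoint_compl_left ?_
      (measurable_truncDev c hq hqb le_rfl), hc, mul_zero]
    exact (measurable_vacant hA hAb (Set.subset_compl_iff_disjoint_right.2 hAq)).mul
      ((hX.measurable_maxColored hk hR hRb).mono
        (countAlgebra_mono fun x hx hxq => hx.2 (Or.inr hxq)) le_rfl)
  rw [hz, zero_add, ← hX.integral_mul hAq (measurable_vacant hA hAb le_rfl)
    ((measurable_truncDev c hq hqb le_rfl).pow_const 2)]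
  congr 1 with ω
  ring

end LowerBound

/-! ### Packing the cube and the order of the variance -/

section Theta

variable {d k : ℕ}

/-- The center of the cube of side `4` with lower corner `4 z`. -/
noncomputable def latticeCenter (z : Fin d → ℕ) : EuclideanSpace ℝ (Fin d) :=
  WithLp.toLp 2 fun i => 4 * (z i : ℝ) + 2

theorem abs_sub_apply_le_dist (x y : EuclideanSpace ℝ (Fin d)) (i : Fin d) :
    |x i - y i| ≤ dist x y := by
  rw [dist_eq_norm, ← Real.norm_eq_abs, ← PiLp.sub_apply]
  exact PiLp.norm_apply_le (x - y) i

theorem four_le_dist_latticeCenter {z w : Fin d → ℕ} (h : z ≠ w) :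
    4 ≤ dist (latticeCenter z) (latticeCenter w) := by
  obtain ⟨i, hi⟩ := Function.ne_iff.1 h
  refine le_trans ?_ (abs_sub_apply_le_dist _ _ i)
  simp only [latticeCenter]
  rcases lt_or_gt_of_ne hi with hlt | hlt
  · have : (z i : ℝ) + 1 ≤ w i := by exact_mod_cast hlt
    rw [abs_sub_comm]
    exact le_trans (by linarith) (le_abs_self _)
  · have : (w i : ℝ) + 1 ≤ z i := by exact_mod_cast hlt
    exact le_trans (by linarith) (le_abs_self _)

theorem closedBall_latticeCenter_subset_cube {z : Fin d → ℕ} {n : ℕ} {t : ℝ} (hn : 4 * (n : ℝ) ≤ t)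
    (hz : ∀ i, z i < n) : Metric.closedBall (latticeCenter z) (3 / 2) ⊆ cube d t := by
  intro x hx i
  have h1 := abs_le.1 ((abs_sub_apply_le_dist x _ i).trans (Metric.mem_closedBall.1 hx))
  have h2 : (z i : ℝ) + 1 ≤ n := by exact_mod_cast hz i
  have h3 : (0 : ℝ) ≤ z i := Nat.cast_nonneg _
  simp only [latticeCenter] at h1
  exact ⟨by linarith [h1.1], by linarith [h1.2]⟩

variable {Ω : Type*} [mΩ : MeasurableSpace Ω] {P : Measure Ω} [IsProbabilityMeasure P]
  {lam : ℝ} {X : Ω → Set (EuclideanSpace ℝ (Fin d))}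

theorem IsPoissonProcess.exists_pos_le_variance_maxColored_cube (hX : IsPoissonProcess lam X P)
    (hk : 0 < k) (hlam : 0 < lam) :
    ∃ σ : ℝ, 0 < σ ∧ ∀ (n : ℕ) (t : ℝ), 4 * (n : ℝ) ≤ t →
      (n : ℝ) ^ d * σ ≤ Var[fun ω => (maxColored k 1 (cube d t ∩ X ω) : ℝ); P] := by
  classical
  -- Radius `1 / 2` gives the core diameter at most `1`; points outside the closed ball of radius `3
  -- / 2` are then more than `1` from the core. Centers are at least `4 > 3` apart, so these larger
  -- balls are disjoint.
  let q : (Fin d → ℕ) → Set (EuclideanSpace ℝ (Fin d)) := fun z =>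
    Metric.ball (latticeCenter z) (1 / 2)
  let D : (Fin d → ℕ) → Set (EuclideanSpace ℝ (Fin d)) := fun z =>
    Metric.closedBall (latticeCenter z) (3 / 2)
  let A : (Fin d → ℕ) → Set (EuclideanSpace ℝ (Fin d)) := fun z => D z \ q z
  have hqm : ∀ z, MeasurableSet (q z) := fun z => measurableSet_ball
  have hqb : ∀ z, Bornology.IsBounded (q z) := fun z => Metric.isBounded_ball
  have hDm : ∀ z, MeasurableSet (D z) := fun z => measurableSet_closedBall
  have hDb : ∀ z, Bornology.IsBounded (D z) := fun z => Metric.isBounded_closedBall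
  have hAm : ∀ z, MeasurableSet (A z) := fun z => (hDm z).diff (hqm z)
  have hAD : ∀ z, A z ⊆ D z := fun z => Set.sdiff_subset
  have hAb : ∀ z, Bornology.IsBounded (A z) := fun z => (hDb z).subset (hAD z)
  have hqD : ∀ z, q z ⊆ D z := fun z =>
    Metric.ball_subset_closedBall.trans (Metric.closedBall_subset_closedBall (by norm_num))
  have hAq : ∀ z, Disjoint (A z) (q z) := fun z => Set.disjoint_sdiff_left
  have hqv : ∀ z, volume (q z) = volume (q 0) := fun z => by
    simp only [q, Measure.addHaar_ball_center]
  have hAv : ∀ z, volume (A z) = volume (A 0) := fun z => by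
    have h : ∀ z, volume (A z) = volume (D 0) - volume (q 0) := fun z => by
      rw [measure_sdiff (hqD z) (hqm z).nullMeasurableSet measure_ball_lt_top.ne, hqv z]
      simp only [D, Measure.addHaar_closedBall_center]
    rw [h z, h 0]
  set a : ℝ≥0 := (lam * (volume (q 0)).toReal).toNNReal with ha
  set b : ℝ≥0 := (lam * (volume (A 0)).toReal).toNNReal
  have hapos : 0 < a := by
    rw [ha, Real.toNNReal_pos]
    exact mul_pos hlam (ENNReal.toReal_pos (Metric.measure_ball_pos _ _ (by norm_num)).ne'
      measure_ball_lt_top.ne)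
  -- Centering at the mean; it serves every `z`, since all cores have the same volume.
  set c : ℝ := ∫ n : ℕ, ((min n k : ℕ) : ℝ) ∂poissonMeasure a with hcdef
  have hc : ∀ z, ∫ ω, truncDev X k c (q z) ω ∂P = 0 := by
    intro z
    unfold truncDev
    rw [hX.integral_count (hqm z) (hqb z) fun n => ((min n k : ℕ) : ℝ) - c, hqv z, integral_sub,
      integral_const, ← hcdef]
    · simp
    · refine (MemLp.of_bound (p := 1) (by fun_prop) (k : ℝ) (ae_of_all _ fun n => ?_)).integrable
        le_rfl
      rw [Real.norm_natCast]
      exact_mod_cast min_le_right n k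
    · exact integrable_const _
  have hσ : ∀ z, (∫ ω, vacant X (A z) ω ∂P) * ∫ ω, truncDev X k c (q z) ω ^ 2 ∂P =
      (∫ n : ℕ, (if n = 0 then (1 : ℝ) else 0) ∂poissonMeasure b) *
        ∫ n : ℕ, ((min n k : ℕ) - c : ℝ) ^ 2 ∂poissonMeasure a := by
    intro z
    unfold truncDev vacant
    rw [hX.integral_count (hqm z) (hqb z) fun n => (((min n k : ℕ) : ℝ) - c) ^ 2,
      hX.integral_count (hAm z) (hAb z) fun n => if n = 0 then (1 : ℝ) else 0, hqv z, hAv z]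
  refine ⟨_, mul_pos (integral_indicator_zero_poissonMeasure_pos b)
    (integral_sq_min_sub_pos hapos hk c), fun n t hnt => ?_⟩
  have hB := (isCompact_cube (d := d) t).measurableSet
  have hb := (isCompact_cube (d := d) t).isBounded
  have hmem : ∀ z ∈ Fintype.piFinset fun _ : Fin d => Finset.range n, ∀ i, z i < n := by
    intro z hz i
    simpa using Fintype.mem_piFinset.1 hz i
  have key := card_mul_le_variance_of_indep (hX.memLp_maxColored hk (r := 1) hB hb)
    (T := fun z ω => vacant X (A z) ω * truncDev X k c (q z) ω)
    (s := Fintype.piFinset fun _ : Fin d => Finset.range n)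
    (fun z _ => hX.memLp_vacant_mul_truncDev c (hAm z) (hAb z) (hqm z) (hqb z)) ?_
    (fun z _ => (hX.variance_vacant_mul_truncDev (hAm z) (hAb z) (hqm z) (hqb z) (hAq z)
      (hc z)).trans (hσ z))
    (fun z hz => (hX.covariance_maxColored_vacant_mul_truncDev hk zero_le_one hB hb (hAm z) (hqm z)
      ((hAD z).trans (closedBall_latticeCenter_subset_cube hnt (hmem z hz)))
      ((hqD z).trans (closedBall_latticeCenter_subset_cube hnt (hmem z hz))) (hAq z) ?_ ?_
      (hc z)).trans (hσ z))
  · simpa [Fintype.card_piFinset_const] using key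
  · intro z _ w _ hzw
    refine hX.indepFun (B := D z) (C := D w) (Metric.closedBall_disjoint_closedBall ?_)
      ((measurable_vacant (hAm z) (hAb z) (hAD z)).mul
        (measurable_truncDev c (hqm z) (hqb z) (hqD z)))
      ((measurable_vacant (hAm w) (hAb w) (hAD w)).mul
        (measurable_truncDev c (hqm w) (hqb w) (hqD w)))
    have := four_le_dist_latticeCenter hzw
    linarith
  · intro x hx y hy
    have h1 := Metric.mem_ball.1 hx
    have h2 := Metric.mem_ball'.1 hy
    have := dist_triangle x (latticeCenter z) y
    linarith
  · intro x hx y hy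
    have hyD : y ∉ D z := fun h => hy.2 (by
      by_cases hyq : y ∈ q z
      · exact Or.inr hyq
      · exact Or.inl ⟨h, hyq⟩)
    have h1 := Metric.mem_ball.1 hx
    have h2 : 3 / 2 < dist y (latticeCenter z) := not_le.1 fun h => hyD (Metric.mem_closedBall.2 h)
    have := dist_triangle y x (latticeCenter z)
    rw [dist_comm y x] at this
    linarith

end Theta

theorem lemma4 {d k : ℕ} (hd : 1 ≤ d) (hk : 1 ≤ k) {lam : ℝ} (hlam : 0 < lam)
    {Ω : Type*} [MeasurableSpace Ω] (P : Measure Ω) [IsProbabilityMeasure P]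
    (X : Ω → Set (EuclideanSpace ℝ (Fin d))) (hX : IsPoissonProcess lam X P) :
    (∀ t : ℝ, 0 ≤ t → MemLp (coloredCount X k t) 2 P) ∧
      (fun t : ℝ => Var[coloredCount X k t; P]) =Θ[atTop] (fun t : ℝ => t ^ d) := by
  refine ⟨fun t _ => hX.memLp_maxColored hk (isCompact_cube t).measurableSet
    (isCompact_cube t).isBounded, ?_, ?_⟩
  · refine IsBigO.of_bound (2 ^ d * ∫ n, (n : ℝ) ^ 2 ∂poissonMeasure
      (lam * (volume (gridCell (0 : Fin d → ℤ))).toReal).toNNReal) ?_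
    filter_upwards [eventually_ge_atTop 1] with t ht
    rw [Real.norm_of_nonneg (variance_nonneg _ _),
      Real.norm_of_nonneg (pow_nonneg (zero_le_one.trans ht) d)]
    exact hX.variance_maxColored_cube_le hk ht
  · obtain ⟨σ, hσ, h⟩ := hX.exists_pos_le_variance_maxColored_cube hk hlam
    refine IsBigO.of_bound (8 ^ d / σ) ?_
    filter_upwards [eventually_ge_atTop 8] with t ht
    rw [Real.norm_of_nonneg (variance_nonneg _ _), Real.norm_of_nonneg (by positivity)]
    have h1 := Nat.floor_le (a := t / 4) (by positivity)
    have h2 := Nat.lt_floor_add_one (t / 4)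
    have h3 := h ⌊t / 4⌋₊ t (by linarith)
    -- From `⌊t / 4⌋₊ > t / 4 - 1` and `t ≥ 8` follows `8 * ⌊t / 4⌋₊ > 2 * t - 8 ≥ t`.
    have h4 : t ^ d ≤ 8 ^ d * (⌊t / 4⌋₊ : ℝ) ^ d := by
      rw [← mul_pow]
      exact pow_le_pow_left₀ (by positivity) (by linarith) d
    calc t ^ d ≤ 8 ^ d * (⌊t / 4⌋₊ : ℝ) ^ d := h4
      _ = 8 ^ d / σ * ((⌊t / 4⌋₊ : ℝ) ^ d * σ) := by field_simp
      _ ≤ 8 ^ d / σ * _ := mul_le_mul_of_nonneg_left h3 (by positivity)
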